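/- Let $M$ be a smooth $n$-dimensional manifold with a smooth Riemannian metric $g$, let $f$ be a smooth function on $M$ and let $\lambda,\mu$ be real constants. Write $\xi=\mathrm{grad}(f)$ and let $\eta=df$ be the $g$-dual $1$-form of $\xi$. Suppose that $(g,\xi,\lambda,\mu)$ is a gradient $\eta$-Ricci soliton, i.e. $$L_\xi g+2S+2\lambda g+2\mu\,\eta\otimes\eta=0\quad\text{on } M,$$ where $L_\xi g$ is the Lie derivative of $g$ and $S$ is the Ricci tensor of $g$. Let $\gamma$ be any smooth $1$-form on $M$. Then, on all of $M$, $$\tfrac12\Delta(\langle df,\gamma\rangle)=\langle \mathrm{Hess}(f),\nabla\gamma\rangle-\mu\,\Delta(f)\,\langle df,\gamma\rangle+\tfrac12\langle df,\Delta(\gamma)\rangle .$$ Here $\nabla$ is the Levi-Civita connection, $\mathrm{Hess}(f)=\nabla df$, and $\langle\cdot,\cdot\rangle$ is the pointwise inner product of $1$-forms, respectively of $(0,2)$-tensor fields: $\langle\alpha,\beta\rangle=\sum_i\alpha(E_i)\beta(E_i)$ and $\langle T_1,T_2\rangle=\sum_{i,j}T_1(E_i,E_j)T_2(E_i,E_j)$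 for a local orthonormal frame $\{E_i\}$. On functions $\Delta u=\mathrm{div}(\mathrm{grad}\,u)$, and on $1$-forms $\Delta=-(d\delta+\delta d)$ is the Laplace-Hodge operator, where $\delta$ is the codifferential (the formal adjoint of $d$). -/

import Mathlib

open scoped Manifold ContDiff Bundle

noncomputable section

namespace EtaRicci

/-! ### Tensor calculus in local coordinates

A function, a vector field, a `1`-form or a `(0,2)`-tensor field on a coordinate domain is given by
its components, which are real functions of the coordinates. -/

/-- Coordinate space. -/
abbrev Coord (n : ℕ) : Type := EuclideanSpace ℝ (Fin n)

/-- Components of a vector field (`X i` is `X^i`) or of a `1`-form (`a i` is `a_i`). -/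
abbrev Tensor1 (n : ℕ) : Type := Fin n → Coord n → ℝ

/-- Components of a `(0,2)`-tensor field (`T i j` is `T_{ij}`). -/
abbrev Tensor2 (n : ℕ) : Type := Fin n → Fin n → Coord n → ℝ

variable {n : ℕ}

/-- The `i`-th partial derivative `∂_i u`. -/
def pd (i : Fin n) (u : Coord n → ℝ) : Coord n → ℝ :=
  fun y => fderiv ℝ u y (EuclideanSpace.single i 1)

/-- The components `G^{ij}` of the inverse of the matrix `(G_{ij})`. -/
def inv (G : Tensor2 n) : Tensor2 n :=
  fun i j y => (Matrix.of fun a b => G a b y)⁻¹ i j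

/-- The Christoffel symbols of the Levi-Civita connection:
`∇_{∂_i} ∂_j = ∑ k, Γ^k_{ij} ∂_k`, where
`Γ^k_{ij} = ½ ∑ l, G^{kl} (∂_i G_{jl} + ∂_j G_{il} - ∂_l G_{ij})`. -/
def christoffel (G : Tensor2 n) (k i j : Fin n) : Coord n → ℝ :=
  fun y => (1 / 2) * ∑ l, inv G k l y *
    (pd i (G j l) y + pd j (G i l) y - pd l (G i j) y)

/-- The curvature tensor: `R(∂_i, ∂_j) ∂_k = ∑ l, R^l_{ijk} ∂_l` with
`R(X, Y) Z = ∇_X ∇_Y Z - ∇_Y ∇_X Z - ∇_{[X, Y]} Z`. -/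
def riemann (G : Tensor2 n) (l i j k : Fin n) : Coord n → ℝ :=
  fun y => pd i (christoffel G l j k) y - pd j (christoffel G l i k) y
    + ∑ m, (christoffel G l i m y * christoffel G m j k y
      - christoffel G l j m y * christoffel G m i k y)

/-- The Ricci tensor `S(Y, Z) = trace (X ↦ R(X, Y) Z)`. -/
def ricci (G : Tensor2 n) : Tensor2 n :=
  fun j k y => ∑ i, riemann G i i j k y

/-- The differential `du` of a function. -/
def dFun (u : Coord n → ℝ) : Tensor1 n := fun i => pd i u

/-- The gradient `(grad u)^i = ∑ j, G^{ij} ∂_j u`. -/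
def grad (G : Tensor2 n) (u : Coord n → ℝ) : Tensor1 n :=
  fun i y => ∑ j, inv G i j y * pd j u y

/-- The `1`-form dual to a vector field, `X♭_i = ∑ j, G_{ij} X^j`. -/
def flat (G : Tensor2 n) (X : Tensor1 n) : Tensor1 n :=
  fun i y => ∑ j, G i j y * X j y

/-- The divergence of a vector field, `div X = trace (∇ X)`. -/
def divVec (G : Tensor2 n) (X : Tensor1 n) : Coord n → ℝ :=
  fun y => ∑ i, (pd i (X i) y + ∑ k, christoffel G i i k y * X k y)

/-- The Lie derivative of the metric,
`(L_X G)_{ij} = ∑ k, (X^k ∂_k G_{ij} + G_{kj} ∂_i X^k + G_{ik} ∂_j X^k)`. -/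
def lieMetric (G : Tensor2 n) (X : Tensor1 n) : Tensor2 n :=
  fun i j y => ∑ k, (X k y * pd k (G i j) y + G k j y * pd i (X k) y + G i k y * pd j (X k) y)

/-- The covariant derivative of a `1`-form,
`(∇ a)_{ij} = (∇_{∂_i} a)(∂_j) = ∂_i a_j - ∑ k, Γ^k_{ij} a_k`. -/
def nabla (G : Tensor2 n) (a : Tensor1 n) : Tensor2 n :=
  fun i j y => pd i (a j) y - ∑ k, christoffel G k i j y * a k y

/-- The covariant derivative of a `(0,2)`-tensor field, `(∇_{∂_k} T)(∂_i, ∂_j)`. -/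
def nabla2 (G : Tensor2 n) (T : Tensor2 n) (k i j : Fin n) : Coord n → ℝ :=
  fun y => pd k (T i j) y - ∑ l, (christoffel G l k i y * T l j y + christoffel G l k j y * T i l y)

/-- The Hessian `Hess u = ∇ du`. -/
def hess (G : Tensor2 n) (u : Coord n → ℝ) : Tensor2 n := nabla G (dFun u)

/-- The pointwise inner product of `1`-forms. -/
def inner1 (G : Tensor2 n) (a b : Tensor1 n) : Coord n → ℝ :=
  fun y => ∑ i, ∑ j, inv G i j y * a i y * b j y

/-- The pointwise inner product of `(0,2)`-tensor fields. -/
def inner2 (G : Tensor2 n) (T U : Tensor2 n) : Coord n → ℝ :=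
  fun y => ∑ i, ∑ j, ∑ k, ∑ l, inv G i k y * inv G j l y * T i j y * U k l y

/-- The Laplacian on functions, `Δ u = div (grad u)`. -/
def laplacian (G : Tensor2 n) (u : Coord n → ℝ) : Coord n → ℝ := divVec G (grad G u)

/-- The exterior derivative of a `1`-form. -/
def dForm (a : Tensor1 n) : Tensor2 n := fun i j y => pd i (a j) y - pd j (a i) y

/-- The codifferential of a `1`-form, `δ a = - ∑ i j, G^{ij} (∇_i a)_j`. -/
def codiff1 (G : Tensor2 n) (a : Tensor1 n) : Coord n → ℝ :=
  fun y => -∑ i, ∑ j, inv G i j y * nabla G a i j y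

/-- The codifferential of a `2`-form, `(δ w)_j = - ∑ k i, G^{ki} (∇_k w)_{ij}`. -/
def codiff2 (G : Tensor2 n) (w : Tensor2 n) : Tensor1 n :=
  fun j y => -∑ k, ∑ i, inv G k i y * nabla2 G w k i j y

/-- The Laplace-Hodge operator on `1`-forms, `Δ = -(d δ + δ d)`; the sign is the one that extends
`Δ u = div (grad u)` on functions. -/
def hodgeLaplacian (G : Tensor2 n) (a : Tensor1 n) : Tensor1 n :=
  fun i y => -(dFun (codiff1 G a) i y + codiff2 G (dForm a) i y)

/-! ### Tensor fields on a manifold and their components in a chart -/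

section Manifold

variable {M : Type*} [TopologicalSpace M] [ChartedSpace (Coord n) M]

/-- Smooth Riemannian metrics on `M`. -/
abbrev Metric (n : ℕ) (M : Type*) [TopologicalSpace M] [ChartedSpace (Coord n) M]
    [IsManifold (𝓡 n) ∞ M] : Type _ :=
  Bundle.ContMDiffRiemannianMetric (𝓡 n) ∞ (Coord n) (fun p : M => TangentSpace (𝓡 n) p)

/-- `1`-forms on `M`, without smoothness. -/
abbrev OneForm (n : ℕ) (M : Type*) [TopologicalSpace M] [ChartedSpace (Coord n) M] : Type _ :=
  ∀ p : M, TangentSpace (𝓡 n) p →L[ℝ] ℝ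

/-- A `1`-form is smooth if it is smooth as a section of the cotangent bundle. -/
def OneForm.IsSmooth [IsManifold (𝓡 n) ∞ M] (a : OneForm n M) : Prop :=
  ContMDiff (𝓡 n) ((𝓡 n).prod 𝓘(ℝ, Coord n →L[ℝ] ℝ)) ∞
    (fun p => Bundle.TotalSpace.mk' (Coord n →L[ℝ] ℝ)
      (E := fun p : M => TangentSpace (𝓡 n) p →L[ℝ] ℝ) p (a p))

/-- The coordinate vector `∂_i` of the chart `e`, at the point with coordinates `y`. -/
def coordVec (e : OpenPartialHomeomorph M (Coord n)) (i : Fin n) (y : Coord n) :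
    TangentSpace (𝓡 n) (e.symm y) :=
  mfderiv (𝓡 n) (𝓡 n) e.symm y (EuclideanSpace.single i (1 : ℝ) : Coord n)

/-- A function on `M` in the coordinates of the chart `e`. -/
def funIn (e : OpenPartialHomeomorph M (Coord n)) (u : M → ℝ) : Coord n → ℝ := fun y => u (e.symm y)

/-- The components `a(∂_i)` of a `1`-form in the chart `e`. -/
def formIn (e : OpenPartialHomeomorph M (Coord n)) (a : OneForm n M) : Tensor1 n :=
  fun i y => a (e.symm y) (coordVec e i y)

/-- The components `g(∂_i, ∂_j)` of a metric in the chart `e`. -/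
def metricIn [IsManifold (𝓡 n) ∞ M] (e : OpenPartialHomeomorph M (Coord n)) (g : Metric n M) :
    Tensor2 n :=
  fun i j y => g.inner (e.symm y) (coordVec e i y) (coordVec e j y)

/-- `(g, grad f, lam, mu)` is a gradient `η`-Ricci soliton, `η` being the `1`-form dual to
`ξ = grad f`: the equation `L_ξ g + 2 S + 2 lam g + 2 mu η ⊗ η = 0` between `(0,2)`-tensor fields
holds on `M`, that is, it holds in components in every smooth chart. -/
def IsGradientEtaRicciSoliton [IsManifold (𝓡 n) ∞ M] (g : Metric n M) (f : M → ℝ)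
    (lam mu : ℝ) : Prop :=
  ∀ e ∈ IsManifold.maximalAtlas (𝓡 n) ∞ M, ∀ y ∈ e.target, ∀ i j : Fin n,
    let G := metricIn e g
    let xi := grad G (funIn e f)
    let eta := flat G xi
    lieMetric G xi i j y + 2 * ricci G i j y + 2 * lam * G i j y
      + 2 * mu * (eta i y * eta j y) = 0

end Manifold

end EtaRicci

end

/-! Write `∇*∇` for the rough Laplacian, the metric trace of `∇∇`. The product rule gives Δ⟨df,γ⟩ =
⟨∇*∇ df, γ⟩ + ⟨df, ∇*∇ γ⟩ + 2⟨Hess f, ∇γ⟩ (`CoordinateMetric.lap_inner`). Commuting covariant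
derivatives gives ∇*∇γ = Δγ + Ric(γ♯) (`hodge_eq`) and ∇*∇ df = d(Δf) + Ric(grad f) (`rough_diff`).
As Ric is symmetric, the two Ricci terms agree, and it remains to evaluate d(Δf) + 2 Ric(grad f).

This is where the soliton equation Hess f + Ric + λg + μ df⊗df = 0 enters. Differentiating its trace
gives d(Δf) + d(tr Ric) + μ d|df|² = 0. Its divergence gives d(Δf) + Ric(grad f) + div Ric + μ(½
d|df|² + Δf df) = 0. Twice the second minus the first, with the contracted Bianchi identity d(tr
Ric) = 2 div Ric, leaves d(Δf) + 2 Ric(grad f) = -2μ Δf df (`IsSoliton.diff_lap`). Halving the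
product rule then yields the formula.

The formula is local, and every identity above uses only ring operations, the Leibniz rule,
commuting partial derivatives and GH = 1. The calculus is therefore carried out over an abstract
commutative algebra with commuting derivations. It is then specialised to the smooth functions on a
chart target, where det G is a unit, and evaluated at a point. -/

/-- A Riemannian metric in coordinates, with a commutative algebra with commuting derivations in
place of the algebra of smooth functions of the coordinates. -/
structure CoordinateMetric (n : ℕ) (A : Type*) [CommRing A] [Algebra ℝ A] where
  /-- the partial derivatives -/
  D : Fin n → Derivation ℝ A A
  D_comm : ∀ i j a, D i (D j a) = D j (D i a)
  /-- the metric -/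
  G : Matrix (Fin n) (Fin n) A
  /-- the inverse metric -/
  H : Matrix (Fin n) (Fin n) A
  G_symm : G.transpose = G
  G_mul_H : G * H = 1

noncomputable section

namespace CoordinateMetric

open Matrix

variable {n : ℕ} {A : Type*} [CommRing A] [Algebra ℝ A] (g : CoordinateMetric n A)

lemma H_mul_G : g.H * g.G = 1 := mul_eq_one_comm.mp g.G_mul_H

lemma H_symm : g.Hᵀ = g.H := by
  have h := congrArg transpose g.G_mul_H
  rw [transpose_mul, g.G_symm, transpose_one] at h
  calc g.Hᵀ = g.Hᵀ * (g.G * g.H) := by rw [g.G_mul_H, mul_one]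
    _ = g.H := by rw [← mul_assoc, h, one_mul]

lemma G_apply_comm (i j : Fin n) : g.G i j = g.G j i := congrFun (congrFun g.G_symm j) i

lemma H_apply_comm (i j : Fin n) : g.H i j = g.H j i := congrFun (congrFun g.H_symm j) i

/-! ### Partial derivatives of vectors and matrices -/

/-- The partial derivative of a vector. -/
def dVec (k : Fin n) (v : Fin n → A) : Fin n → A := fun i => g.D k (v i)

/-- The partial derivative of a matrix. -/
def dMat (k : Fin n) (T : Matrix (Fin n) (Fin n) A) : Matrix (Fin n) (Fin n) A := T.map (g.D k)

lemma dMat_apply (k i j : Fin n) (T : Matrix (Fin n) (Fin n) A) :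
    g.dMat k T i j = g.D k (T i j) := rfl

lemma dMat_add (k : Fin n) (S T : Matrix (Fin n) (Fin n) A) :
    g.dMat k (S + T) = g.dMat k S + g.dMat k T := by
  ext i j; simp [dMat]

lemma dMat_sub (k : Fin n) (S T : Matrix (Fin n) (Fin n) A) :
    g.dMat k (S - T) = g.dMat k S - g.dMat k T := by
  ext i j; simp [dMat]

lemma dMat_neg (k : Fin n) (T : Matrix (Fin n) (Fin n) A) :
    g.dMat k (-T) = -g.dMat k T := by
  ext i j; simp [dMat]

lemma dMat_one (k : Fin n) : g.dMat k 1 = 0 := by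
  ext i j
  by_cases h : i = j
  · subst h; simp [dMat]
  · simp [dMat, h]

lemma dMat_transpose (k : Fin n) (T : Matrix (Fin n) (Fin n) A) :
    g.dMat k Tᵀ = (g.dMat k T)ᵀ := rfl

lemma dMat_mul (k : Fin n) (S T : Matrix (Fin n) (Fin n) A) :
    g.dMat k (S * T) = g.dMat k S * T + S * g.dMat k T := by
  ext i j
  simp only [dMat, map_apply, Matrix.mul_apply, map_sum, Derivation.leibniz, smul_eq_mul,
    Matrix.add_apply, ← Finset.sum_add_distrib]
  exact Finset.sum_congr rfl fun l _ => by ring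

lemma dMat_comm (k l : Fin n) (T : Matrix (Fin n) (Fin n) A) :
    g.dMat k (g.dMat l T) = g.dMat l (g.dMat k T) := by
  ext i j; exact g.D_comm k l _

lemma dMat_smul (k : Fin n) (c : ℝ) (T : Matrix (Fin n) (Fin n) A) :
    g.dMat k (c • T) = c • g.dMat k T := by
  ext i j; simp [dMat]

lemma dVec_add (k : Fin n) (v w : Fin n → A) : g.dVec k (v + w) = g.dVec k v + g.dVec k w := by
  ext i; simp [dVec]

lemma dVec_sub (k : Fin n) (v w : Fin n → A) : g.dVec k (v - w) = g.dVec k v - g.dVec k w := by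
  ext i; simp [dVec]

lemma dVec_mulVec (k : Fin n) (T : Matrix (Fin n) (Fin n) A) (v : Fin n → A) :
    g.dVec k (T *ᵥ v) = g.dMat k T *ᵥ v + T *ᵥ g.dVec k v := by
  ext i
  simp only [dVec, dMat, map_apply, mulVec, dotProduct, map_sum, Derivation.leibniz, smul_eq_mul,
    Pi.add_apply, ← Finset.sum_add_distrib]
  exact Finset.sum_congr rfl fun l _ => by ring

lemma dVec_comm (k l : Fin n) (v : Fin n → A) :
    g.dVec k (g.dVec l v) = g.dVec l (g.dVec k v) := by
  ext i; exact g.D_comm k l _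

lemma D_dotProduct (k : Fin n) (v w : Fin n → A) :
    g.D k (v ⬝ᵥ w) = g.dVec k v ⬝ᵥ w + v ⬝ᵥ g.dVec k w := by
  simp only [dVec, dotProduct, map_sum, Derivation.leibniz, smul_eq_mul,
    ← Finset.sum_add_distrib]
  exact Finset.sum_congr rfl fun l _ => by ring

lemma D_trace (k : Fin n) (T : Matrix (Fin n) (Fin n) A) :
    g.D k T.trace = (g.dMat k T).trace := by
  simp [trace, dMat]

/-! ### The Levi-Civita connection -/

/-- The Christoffel symbols `Γ^k_{ij}`. -/
def chr (k i j : Fin n) : A :=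
  (1 / 2 : ℝ) • ∑ l, g.H k l * (g.D i (g.G j l) + g.D j (g.G i l) - g.D l (g.G i j))

lemma chr_comm (k i j : Fin n) : g.chr k i j = g.chr k j i := by
  simp only [chr, g.G_apply_comm i j]
  congr 1
  exact Finset.sum_congr rfl fun l _ => by ring

/-- The connection matrices `(Γ_i)^k_j = Γ^k_{ij}`. -/
def conn (i : Fin n) : Matrix (Fin n) (Fin n) A := of fun k j => g.chr k i j

lemma conn_apply (i k j : Fin n) : g.conn i k j = g.chr k i j := rfl

lemma conn_apply_comm (i k j : Fin n) : g.conn i k j = g.conn j k i := g.chr_comm k i j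

/-- Lowering the upper index cancels the inverse metric and leaves the Christoffel symbols of the
first kind. -/
lemma G_mul_conn_apply (k l j : Fin n) : (g.G * g.conn k) l j =
    (1 / 2 : ℝ) • (g.D k (g.G j l) + g.D j (g.G k l) - g.D l (g.G k j)) := by
  set v : Fin n → A := fun l => g.D k (g.G j l) + g.D j (g.G k l) - g.D l (g.G k j) with hv
  have h : ∀ m, g.conn k m j = (1 / 2 : ℝ) • (g.H *ᵥ v) m := fun m => rfl
  calc (g.G * g.conn k) l j = (g.G *ᵥ ((1 / 2 : ℝ) • (g.H *ᵥ v))) l := by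
        simp only [Matrix.mul_apply, mulVec, dotProduct, h, Pi.smul_apply]
    _ = ((1 / 2 : ℝ) • v) l := by
        rw [mulVec_smul, mulVec_mulVec, g.G_mul_H, one_mulVec]

/-- Metric compatibility: symmetrising the first-kind symbols in `i` and `j` cancels all terms but
`∂_k G_{ij}`. -/
lemma dMat_G (k : Fin n) : g.dMat k g.G = (g.conn k)ᵀ * g.G + g.G * g.conn k := by
  have h : (g.conn k)ᵀ * g.G = (g.G * g.conn k)ᵀ := by rw [transpose_mul, g.G_symm]
  rw [h]
  ext i j
  rw [Matrix.add_apply, transpose_apply, G_mul_conn_apply, G_mul_conn_apply, ← smul_add, dMat_apply,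
    g.G_apply_comm j i, g.G_apply_comm k i, g.G_apply_comm k j]
  have : g.D k (g.G i j) + g.D i (g.G j k) - g.D j (g.G i k)
      + (g.D k (g.G i j) + g.D j (g.G i k) - g.D i (g.G j k)) = (2 : ℝ) • g.D k (g.G i j) := by
    rw [two_smul]; ring
  rw [this, smul_smul]; norm_num

/-- Obtained by differentiating `H * G = 1` and multiplying by `H` on the right. -/
lemma dMat_H (k : Fin n) : g.dMat k g.H = -(g.conn k * g.H) - g.H * (g.conn k)ᵀ := by
  have h := g.dMat_one k
  rw [← g.H_mul_G, dMat_mul, dMat_G] at h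
  have h2 := congrArg (· * g.H) h
  simp only [Matrix.add_mul, Matrix.mul_add, Matrix.mul_assoc, g.G_mul_H, mul_one, zero_mul] at h2
  rw [← Matrix.mul_assoc g.H g.G, g.H_mul_G, one_mul] at h2
  rw [eq_sub_iff_add_eq, eq_neg_iff_add_eq_zero, ← h2]
  abel

/-- The covariant derivative `∇_k` of a `1`-form. -/
def cov1 (k : Fin n) (a : Fin n → A) : Fin n → A := g.dVec k a - (g.conn k)ᵀ *ᵥ a

/-- The covariant derivative `(∇ a)_{ij}` of a `1`-form. -/
def cov (a : Fin n → A) : Matrix (Fin n) (Fin n) A := of fun i => g.cov1 i a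

/-- The covariant derivative `∇_k` of a `(0,2)`-tensor. -/
def cov2 (k : Fin n) (T : Matrix (Fin n) (Fin n) A) : Matrix (Fin n) (Fin n) A :=
  g.dMat k T - (g.conn k)ᵀ * T - T * g.conn k

lemma cov2_add (k : Fin n) (S T : Matrix (Fin n) (Fin n) A) :
    g.cov2 k (S + T) = g.cov2 k S + g.cov2 k T := by
  simp only [cov2, dMat_add]; noncomm_ring

lemma cov2_sub (k : Fin n) (S T : Matrix (Fin n) (Fin n) A) :
    g.cov2 k (S - T) = g.cov2 k S - g.cov2 k T := by
  simp only [cov2, dMat_sub]; noncomm_ring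

lemma cov2_smul (k : Fin n) (c : ℝ) (T : Matrix (Fin n) (Fin n) A) :
    g.cov2 k (c • T) = c • g.cov2 k T := by
  simp only [cov2, dMat_smul, smul_sub, mul_smul_comm, smul_mul_assoc]

lemma cov2_zero (k : Fin n) : g.cov2 k 0 = 0 := by
  simpa using g.cov2_smul k 0 0

lemma cov2_transpose (k : Fin n) (T : Matrix (Fin n) (Fin n) A) :
    g.cov2 k Tᵀ = (g.cov2 k T)ᵀ := by
  simp only [cov2, dMat_transpose, transpose_sub, transpose_mul, transpose_transpose]
  abel

lemma cov2_G (k : Fin n) : g.cov2 k g.G = 0 := by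
  rw [cov2, dMat_G]; abel

lemma cov2_vecMulVec (k : Fin n) (a b : Fin n → A) :
    g.cov2 k (vecMulVec a b) = vecMulVec (g.cov1 k a) b + vecMulVec a (g.cov1 k b) := by
  have h : g.dMat k (vecMulVec a b) = vecMulVec (g.dVec k a) b + vecMulVec a (g.dVec k b) := by
    ext i j
    simp only [dMat_apply, vecMulVec_apply, Derivation.leibniz, smul_eq_mul, Matrix.add_apply, dVec]
    ring
  rw [cov2, h, cov1, cov1, mul_vecMulVec, vecMulVec_mul, sub_vecMulVec, vecMulVec_sub,
    ← vecMul_transpose, transpose_transpose]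
  rw [← vecMul_transpose (g.conn k)ᵀ b, transpose_transpose]
  abel

/-- The trace `∑ i j, H^{ij} T_{ij}`. -/
def tr (T : Matrix (Fin n) (Fin n) A) : A := (g.H * T).trace

lemma tr_eq_sum (T : Matrix (Fin n) (Fin n) A) : g.tr T = ∑ i, ∑ j, g.H i j * T i j := by
  rw [tr, trace, Finset.sum_comm]
  refine Finset.sum_congr rfl fun i _ => ?_
  rw [diag_apply, Matrix.mul_apply]
  exact Finset.sum_congr rfl fun j _ => by rw [g.H_apply_comm i j]

/-- The inverse metric is parallel: the connection terms from `H` and from `T` cancel by cyclicity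
of the trace. -/
lemma D_tr (k : Fin n) (T : Matrix (Fin n) (Fin n) A) : g.D k (g.tr T) = g.tr (g.cov2 k T) := by
  rw [tr, tr, D_trace, dMat_mul, dMat_H, cov2]
  simp only [Matrix.sub_mul, Matrix.mul_sub, trace_add, trace_sub, Matrix.neg_mul, trace_neg]
  rw [Matrix.mul_assoc (g.conn k), trace_mul_comm (g.conn k), Matrix.mul_assoc g.H T,
    Matrix.mul_assoc g.H (g.conn k)ᵀ]
  ring

/-- The inner product of `1`-forms. -/
def inner (a b : Fin n → A) : A := a ⬝ᵥ (g.H *ᵥ b)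

lemma inner_comm (a b : Fin n → A) : g.inner a b = g.inner b a := by
  rw [inner, inner, dotProduct_mulVec, ← mulVec_transpose, g.H_symm, dotProduct_comm]

/-- Raising an index commutes with `∇_k`; the last term is the connection acting on vectors. -/
lemma dVec_H_mulVec (k : Fin n) (a : Fin n → A) :
    g.dVec k (g.H *ᵥ a) = g.H *ᵥ g.cov1 k a - g.conn k *ᵥ (g.H *ᵥ a) := by
  rw [dVec_mulVec, dMat_H, cov1]
  simp only [sub_mulVec, neg_mulVec, mulVec_sub, mulVec_mulVec]
  abel

lemma D_inner (k : Fin n) (a b : Fin n → A) :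
    g.D k (g.inner a b) = g.inner (g.cov1 k a) b + g.inner a (g.cov1 k b) := by
  rw [inner, D_dotProduct, dVec_H_mulVec, inner, inner, dotProduct_sub,
    dotProduct_mulVec a (g.conn k), ← mulVec_transpose (g.conn k) a, show g.cov1 k a =
    g.dVec k a - (g.conn k)ᵀ *ᵥ a from rfl, sub_dotProduct]
  ring

/-- The covariant derivative of the contraction of a `(0,2)`-tensor and a `1`-form. -/
lemma cov1_mulVec (k : Fin n) (T : Matrix (Fin n) (Fin n) A) (b : Fin n → A) :
    g.cov1 k (T *ᵥ (g.H *ᵥ b)) =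
      g.cov2 k T *ᵥ (g.H *ᵥ b) + T *ᵥ (g.H *ᵥ g.cov1 k b) := by
  rw [cov1, dVec_mulVec, dVec_H_mulVec, cov2]
  simp only [mulVec_sub, mulVec_mulVec, Matrix.mul_assoc, Matrix.sub_mul, sub_mulVec]
  abel

/-! ### Curvature -/

/-- The curvature matrices `(R_{ij})^l_k = R^l_{ijk}`. -/
def curv (i j : Fin n) : Matrix (Fin n) (Fin n) A :=
  g.dMat i (g.conn j) - g.dMat j (g.conn i) + g.conn i * g.conn j - g.conn j * g.conn i

/-- The Ricci tensor. -/
def ric : Matrix (Fin n) (Fin n) A := of fun j k => ∑ i, g.curv i j i k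

lemma curv_antisymm (i j : Fin n) : g.curv i j = -g.curv j i := by
  rw [curv, curv]; abel

/-- Skewness of the curvature is the integrability condition of `dMat_H`: expand both sides of `∂_i
∂_j H = ∂_j ∂_i H`. -/
lemma curv_mul_H_antisymm (i j : Fin n) :
    g.curv i j * g.H + (g.curv i j * g.H)ᵀ = 0 := by
  have h := g.dMat_comm i j g.H
  rw [g.dMat_H j, g.dMat_H i] at h
  simp only [dMat_sub, dMat_neg, dMat_mul, dMat_H, dMat_transpose] at h
  rw [transpose_mul, g.H_symm, curv]
  simp only [transpose_sub, transpose_add, transpose_mul]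
  rw [← sub_eq_zero] at h
  rw [← neg_eq_zero, ← h]
  noncomm_ring

/-- The Ricci identity. -/
lemma cov2_cov_sub (k j : Fin n) (a : Fin n → A) :
    g.cov2 k (g.cov a) j - g.cov2 j (g.cov a) k = -((g.curv k j)ᵀ *ᵥ a) := by
  -- The correction for the differentiation index is symmetric in `k`, `j` because there is no
  -- torsion, so it drops out of the commutator.
  have h : ∀ k j, g.cov2 k (g.cov a) j =
      g.cov1 k (g.cov1 j a) - fun i => ∑ l, g.chr l k j * g.cov a l i := by
    intro k j
    ext i
    simp only [cov2, Matrix.sub_apply, Matrix.mul_apply, transpose_apply, conn_apply, Pi.sub_apply,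
      cov1, mulVec, dotProduct, dMat_apply, dVec, cov, of_apply]
    simp only [mul_comm]
    ring
  have h2 : (fun i => ∑ l, g.chr l k j * g.cov a l i) =
      fun i => ∑ l, g.chr l j k * g.cov a l i := by simp only [g.chr_comm _ k j]
  rw [h, h, h2, sub_sub_sub_cancel_right]
  simp only [cov1, dVec_sub, dVec_mulVec, dMat_transpose, curv, mulVec_sub, transpose_sub,
    transpose_add, transpose_mul, sub_mulVec, add_mulVec, mulVec_mulVec, g.dVec_comm k j]
  abel

/-! ### The Bianchi identities -/

/-- The covariant derivative of the curvature, as an endomorphism valued `2`-form. -/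
def covCurv (k i j : Fin n) : Matrix (Fin n) (Fin n) A :=
  g.dMat k (g.curv i j) + g.conn k * g.curv i j - g.curv i j * g.conn k
    - ∑ m, (g.chr m k i • g.curv m j + g.chr m k j • g.curv i m)

lemma covCurv_antisymm (k i j : Fin n) : g.covCurv k i j = -g.covCurv k j i := by
  simp only [covCurv, g.curv_antisymm j i, g.curv_antisymm j _, g.curv_antisymm _ i, dMat_neg,
    Finset.sum_add_distrib, smul_neg, Finset.sum_neg_distrib]
  noncomm_ring

/-- The second Bianchi identity. -/
lemma covCurv_cyclic (i j k : Fin n) :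
    g.covCurv k i j + g.covCurv i j k + g.covCurv j k i = 0 := by
  -- The part acting on the endomorphism vanishes by the Jacobi identity for the operators `∂_i +
  -- Γ_i`.
  have h : g.dMat k (g.curv i j) + g.conn k * g.curv i j - g.curv i j * g.conn k
      + (g.dMat i (g.curv j k) + g.conn i * g.curv j k - g.curv j k * g.conn i)
      + (g.dMat j (g.curv k i) + g.conn j * g.curv k i - g.curv k i * g.conn j) = 0 := by
    simp only [curv, dMat_sub, dMat_add, dMat_mul, g.dMat_comm k i, g.dMat_comm k j,
      g.dMat_comm j i]
    noncomm_ring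
  -- The corrections for the two form indices cancel in pairs, by symmetry of `Γ` and skewness of
  -- the curvature.
  have hs : ∑ m, (g.chr m k i • g.curv m j + g.chr m k j • g.curv i m)
      + ∑ m, (g.chr m i j • g.curv m k + g.chr m i k • g.curv j m)
      + ∑ m, (g.chr m j k • g.curv m i + g.chr m j i • g.curv k m) = 0 := by
    rw [← Finset.sum_add_distrib, ← Finset.sum_add_distrib]
    refine Finset.sum_eq_zero fun m _ => ?_
    rw [g.curv_antisymm m j, g.curv_antisymm m k, g.curv_antisymm m i, g.chr_comm m i k,
      g.chr_comm m j k, g.chr_comm m j i]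
    simp only [smul_neg]
    abel
  rw [← sub_zero (0 : Matrix (Fin n) (Fin n) A)]
  nth_rewrite 1 [← h]
  rw [← hs]
  simp only [covCurv]
  abel

/-- Since `H` is parallel, the skewness of the curvature survives covariant differentiation. -/
lemma covCurv_mul_H_antisymm (k i j : Fin n) :
    g.covCurv k i j * g.H + (g.covCurv k i j * g.H)ᵀ = 0 := by
  have h := g.curv_mul_H_antisymm i j
  have h1 := congrArg (g.dMat k) h
  have h0 : g.dMat k 0 = 0 := by ext; simp [dMat]
  have hs : (∑ m, (g.chr m k i • g.curv m j + g.chr m k j • g.curv i m)) * g.H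
      + ((∑ m, (g.chr m k i • g.curv m j + g.chr m k j • g.curv i m)) * g.H)ᵀ = 0 := by
    rw [Finset.sum_mul, transpose_sum, ← Finset.sum_add_distrib]
    refine Finset.sum_eq_zero fun m _ => ?_
    have h2 := congrArg (g.chr m k i • ·) (g.curv_mul_H_antisymm m j)
    have h3 := congrArg (g.chr m k j • ·) (g.curv_mul_H_antisymm i m)
    simp only [smul_add, smul_zero] at h2 h3
    simp only [Matrix.add_mul, transpose_add, Matrix.smul_mul, transpose_smul]
    rw [← add_zero (0 : Matrix (Fin n) (Fin n) A)]
    nth_rewrite 1 [← h2]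
    rw [← h3]
    abel
  set C := g.curv i j
  set Q := ∑ m, (g.chr m k i • g.curv m j + g.chr m k j • g.curv i m) with hQ
  set K := g.conn k with hK
  have e1 : g.covCurv k i j = g.dMat k C + K * C - C * K - Q := rfl
  -- Supplies the connection terms that turn the partial derivative of the skewness identity into
  -- its covariant derivative.
  have e2 : K * (C * g.H + (C * g.H)ᵀ) + (C * g.H + (C * g.H)ᵀ) * Kᵀ = 0 := by
    rw [h]; simp
  rw [h0, dMat_add, dMat_transpose, dMat_mul, dMat_H] at h1
  rw [e1]
  simp only [transpose_add, transpose_sub, transpose_mul, transpose_neg, transpose_transpose,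
    g.H_symm, Matrix.add_mul, Matrix.sub_mul, Matrix.mul_add, Matrix.mul_sub, Matrix.mul_neg,
    ← hK] at h1 e2 hs ⊢
  simp only [Matrix.mul_assoc] at h1 e2 hs ⊢
  rw [← sub_eq_zero] at h1
  have := congrArg₂ (· - ·) (congrArg₂ (· + ·) h1 e2) hs
  simp only [sub_zero, add_zero] at this
  rw [← this]
  abel

/-- `∇` commutes with the contraction defining Ricci: the connection terms on the two contracted
indices cancel. -/
lemma sum_covCurv (k j m : Fin n) : ∑ i, g.covCurv k i j i m = g.cov2 k g.ric j m := by
  have h1 : ∑ i, ∑ l, g.chr l k i * g.curv l j i m = ∑ i, ∑ l, g.chr i k l * g.curv i j l m :=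
    Finset.sum_comm
  have h2 : ∑ i, ∑ l, g.chr l k j * g.curv i l i m = ∑ l, g.chr l k j * g.ric l m := by
    rw [Finset.sum_comm]
    simp only [ric, of_apply, Finset.mul_sum]
  have h3 : ∑ i, ∑ l, g.curv i j i l * g.chr l k m = ∑ l, g.ric j l * g.chr l k m := by
    rw [Finset.sum_comm]
    simp only [ric, of_apply, Finset.sum_mul]
  simp only [covCurv, Matrix.add_apply, Matrix.sub_apply, Matrix.sum_apply, Matrix.smul_apply,
    smul_eq_mul, Matrix.mul_apply, conn_apply, Finset.sum_add_distrib, Finset.sum_sub_distrib,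
    dMat_apply, cov2, transpose_apply]
  rw [h1, h2, h3]
  simp only [ric, of_apply, map_sum]
  ring

/-- The contracted second Bianchi identity. -/
lemma contracted_bianchi (k : Fin n) :
    g.D k (g.tr g.ric) = 2 * ∑ j, ∑ m, g.H j m * g.cov2 j g.ric k m := by
  -- First contraction of the second Bianchi identity; skewness in the form indices produces the
  -- minus sign.
  have h : ∀ j m, g.cov2 k g.ric j m + ∑ i, g.covCurv i j k i m - g.cov2 j g.ric k m = 0 := by
    intro j m
    rw [← sum_covCurv, ← sum_covCurv, ← Finset.sum_add_distrib, ← Finset.sum_sub_distrib]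
    refine Finset.sum_eq_zero fun i _ => ?_
    have := congrFun (congrFun (g.covCurv_cyclic i j k) i) m
    rw [g.covCurv_antisymm j k i] at this
    simpa [sub_eq_add_neg] using this
  -- Second contraction: skewness in the endomorphism indices makes this term another divergence of
  -- Ricci, whence the factor 2.
  have hs : ∑ j, ∑ m, g.H j m * ∑ i, g.covCurv i j k i m =
      -∑ j, ∑ m, g.H j m * g.cov2 j g.ric k m := by
    have e1 : ∀ i j, ∑ m, g.H j m * g.covCurv i j k i m =
        -∑ m, g.H i m * g.covCurv i j k j m := by
      intro i j
      have := congrFun (congrFun (g.covCurv_mul_H_antisymm i j k) i) j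
      simp only [Matrix.add_apply, transpose_apply, Matrix.mul_apply, Matrix.zero_apply] at this
      rw [← eq_neg_iff_add_eq_zero] at this
      simpa only [g.H_apply_comm _ i, g.H_apply_comm _ j, mul_comm] using this
    calc ∑ j, ∑ m, g.H j m * ∑ i, g.covCurv i j k i m
        = ∑ j, ∑ i, ∑ m, g.H j m * g.covCurv i j k i m := by
          simp only [Finset.mul_sum]
          exact Finset.sum_congr rfl fun j _ => Finset.sum_comm
      _ = -∑ i, ∑ m, g.H i m * ∑ j, g.covCurv i j k j m := by
          simp only [e1, Finset.sum_neg_distrib, Finset.mul_sum]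
          rw [Finset.sum_comm]
          congr 1
          exact Finset.sum_congr rfl fun j _ => Finset.sum_comm
      _ = _ := by simp only [sum_covCurv]
  have h3 : ∑ j, ∑ m, g.H j m *
      (g.cov2 k g.ric j m + ∑ i, g.covCurv i j k i m - g.cov2 j g.ric k m) = 0 := by
    simp [h]
  simp only [mul_add, mul_sub, Finset.sum_add_distrib, Finset.sum_sub_distrib] at h3
  rw [hs] at h3
  rw [D_tr, tr_eq_sum]
  linear_combination h3

end CoordinateMetric

end

noncomputable section

namespace CoordinateMetric

open Matrix

variable {n : ℕ} {A : Type*} [CommRing A] [Algebra ℝ A] (g : CoordinateMetric n A)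

/-! ### Divergence, Laplacians, and the Bochner formula -/

/-- The differential of a function. -/
def diff (u : A) : Fin n → A := fun i => g.D i u

/-- The Laplacian on functions. -/
def lap (u : A) : A := g.tr (g.cov (g.diff u))

/-- The rough Laplacian `∑ i j, H^{ij} ∇_i ∇_j a` on `1`-forms. -/
def rough (a : Fin n → A) : Fin n → A := ∑ k, ∑ j, g.H k j • g.cov2 k (g.cov a) j

/-- The divergence `∑ j m, H^{jm} ∇_j T_{km}` of a `(0,2)`-tensor in its second index. -/
def div2 (T : Matrix (Fin n) (Fin n) A) (k : Fin n) : A := ∑ j, ∑ m, g.H j m * g.cov2 j T k m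

/-- The inner product of `(0,2)`-tensors. -/
def inner2 (S T : Matrix (Fin n) (Fin n) A) : A := ∑ i, ∑ k, g.H i k * g.inner (S i) (T k)

/-- The codifferential of a `2`-form. -/
def codiff2 (w : Matrix (Fin n) (Fin n) A) : Fin n → A :=
  fun j => -∑ k, ∑ i, g.H k i * g.cov2 k w i j

/-- The Laplace-Hodge operator on `1`-forms. -/
def hodge (a : Fin n → A) : Fin n → A :=
  fun i => -(g.D i (-g.tr (g.cov a)) + g.codiff2 (g.cov a - (g.cov a)ᵀ) i)

/-- The symmetric Christoffel terms cancel, so `da` is the antisymmetrised `∇a`. -/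
lemma cov_sub_transpose (a : Fin n → A) :
    g.cov a - (g.cov a)ᵀ = of fun i j => g.D i (a j) - g.D j (a i) := by
  ext i j
  simp only [cov, cov1, Matrix.sub_apply, of_apply, transpose_apply, Pi.sub_apply, mulVec,
    dotProduct, dVec, g.conn_apply_comm i]
  ring

lemma cov_diff_symm (u : A) : (g.cov (g.diff u))ᵀ = g.cov (g.diff u) := by
  have h := g.cov_sub_transpose (g.diff u)
  have h0 : (of fun i j => g.D i (g.diff u j) - g.D j (g.diff u i)) =
      (0 : Matrix (Fin n) (Fin n) A) := by
    ext i j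
    simp [diff, g.D_comm i j]
  rw [h0, sub_eq_zero] at h
  exact h.symm

lemma inner2_comm (S T : Matrix (Fin n) (Fin n) A) : g.inner2 S T = g.inner2 T S := by
  rw [inner2, inner2, Finset.sum_comm]
  refine Finset.sum_congr rfl fun i _ => Finset.sum_congr rfl fun j _ => ?_
  rw [g.inner_comm (S j), g.H_apply_comm]

lemma tr_vecMulVec (a b : Fin n → A) : g.tr (vecMulVec a b) = g.inner a b := by
  rw [tr, mul_vecMulVec, trace_vecMulVec, dotProduct_comm, g.inner_comm, inner]

lemma tr_add (S T : Matrix (Fin n) (Fin n) A) : g.tr (S + T) = g.tr S + g.tr T := by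
  simp [tr, Matrix.mul_add]

lemma tr_smul (c : ℝ) (T : Matrix (Fin n) (Fin n) A) : g.tr (c • T) = c • g.tr T := by
  simp [tr]

lemma inner_add_left (a b c : Fin n → A) : g.inner (a + b) c = g.inner a c + g.inner b c :=
  add_dotProduct _ _ _

lemma inner_sub_left (a b c : Fin n → A) : g.inner (a - b) c = g.inner a c - g.inner b c :=
  sub_dotProduct _ _ _

lemma inner_smul_left (r : A) (a c : Fin n → A) : g.inner (r • a) c = r * g.inner a c :=
  smul_dotProduct _ _ _

lemma inner_rough (a b : Fin n → A) :
    g.inner (g.rough a) b = ∑ k, ∑ j, g.H k j * g.inner (g.cov2 k (g.cov a) j) b := by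
  simp only [inner, rough, sum_dotProduct, smul_dotProduct, smul_eq_mul]

lemma diff_inner (a b : Fin n → A) :
    g.diff (g.inner a b) = g.cov a *ᵥ (g.H *ᵥ b) + g.cov b *ᵥ (g.H *ᵥ a) := by
  ext k
  rw [diff, D_inner, g.inner_comm a]
  rfl

lemma cov1_add (k : Fin n) (a b : Fin n → A) : g.cov1 k (a + b) = g.cov1 k a + g.cov1 k b := by
  rw [cov1, cov1, cov1, dVec_add, mulVec_add]; abel

/-- Two applications of the Leibniz rule; each factor contributes one copy of the mixed term. -/
lemma lap_inner (a b : Fin n → A) : g.lap (g.inner a b) =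
    g.inner (g.rough a) b + g.inner (g.rough b) a + 2 * g.inner2 (g.cov a) (g.cov b) := by
  have h : ∀ a b : Fin n → A, ∑ k, ∑ j, g.H k j * g.cov1 k (g.cov a *ᵥ (g.H *ᵥ b)) j =
      g.inner (g.rough a) b + g.inner2 (g.cov a) (g.cov b) := by
    intro a b
    rw [g.inner2_comm, inner2, inner_rough, ← Finset.sum_add_distrib]
    refine Finset.sum_congr rfl fun k _ => ?_
    rw [← Finset.sum_add_distrib]
    refine Finset.sum_congr rfl fun j _ => ?_
    rw [cov1_mulVec, Pi.add_apply, mul_add, g.inner_comm (g.cov b k)]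
    rfl
  rw [lap, diff_inner, tr_eq_sum]
  simp only [cov, of_apply, cov1_add, Pi.add_apply, mul_add, Finset.sum_add_distrib]
  have h1 := h a b
  have h2 := h b a
  rw [g.inner2_comm (g.cov b)] at h2
  simp only [cov] at h1 h2
  rw [h1, h2]
  ring

/-- The Ricci identity exchanges the two derivatives, and the curvature it produces contracts to
Ricci. -/
lemma div2_cov (a : Fin n → A) (j : Fin n) :
    g.div2 (g.cov a) j = g.D j (g.tr (g.cov a)) + (g.ric *ᵥ (g.H *ᵥ a)) j := by
  have hskew : ∀ k l, ∑ i, g.H k i * g.curv k j l i = -∑ i, g.curv k j k i * g.H i l := by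
    intro k l
    have := congrFun (congrFun (g.curv_mul_H_antisymm k j) l) k
    simp only [Matrix.add_apply, transpose_apply, Matrix.mul_apply, Matrix.zero_apply] at this
    rw [← eq_neg_iff_add_eq_zero] at this
    rw [← this]
    exact Finset.sum_congr rfl fun i _ => by rw [g.H_apply_comm k i, mul_comm]
  have h : ∀ k i, g.cov2 k (g.cov a) j i =
      g.cov2 j (g.cov a) k i - ∑ l, g.curv k j l i * a l := by
    intro k i
    have := congrFun (g.cov2_cov_sub k j a) i
    simp only [Pi.sub_apply, Pi.neg_apply, mulVec, dotProduct, transpose_apply] at this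
    linear_combination this
  rw [div2, D_tr, tr_eq_sum]
  simp only [h, mul_sub, Finset.sum_sub_distrib]
  rw [sub_eq_add_neg, add_right_inj, ← Finset.sum_neg_distrib]
  calc ∑ k, -∑ i, g.H k i * ∑ l, g.curv k j l i * a l
      = ∑ k, ∑ l, -(∑ i, g.H k i * g.curv k j l i) * a l := by
        refine Finset.sum_congr rfl fun k _ => ?_
        simp only [Finset.mul_sum, Finset.sum_mul, neg_mul, Finset.sum_neg_distrib]
        rw [Finset.sum_comm]
        simp only [mul_assoc]
    _ = ∑ l, ∑ i, ∑ k, g.curv k j k i * g.H i l * a l := by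
        simp only [hskew, neg_neg, Finset.sum_mul]
        rw [Finset.sum_comm]
        exact Finset.sum_congr rfl fun l _ => Finset.sum_comm
    _ = (g.ric *ᵥ (g.H *ᵥ a)) j := by
        simp only [mulVec, dotProduct, ric, of_apply, Finset.sum_mul, Finset.mul_sum, mul_assoc]
        rw [Finset.sum_comm]

lemma rough_apply (a : Fin n → A) (j : Fin n) :
    g.rough a j = ∑ k, ∑ i, g.H k i * g.cov2 k (g.cov a) i j := by
  simp [rough, Finset.sum_apply]

/-- The Weitzenböck formula. -/
lemma hodge_eq (a : Fin n → A) : g.hodge a = g.rough a - g.ric *ᵥ (g.H *ᵥ a) := by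
  ext j
  -- In `-δda` the transposed part of `da` contributes minus this divergence; its `d(div a)` cancels
  -- `-dδa`, leaving only Ricci.
  have h := g.div2_cov a j
  rw [div2] at h
  rw [hodge, codiff2, Pi.sub_apply, rough_apply]
  simp only [cov2_sub, cov2_transpose, Matrix.sub_apply, transpose_apply, mul_sub,
    Finset.sum_sub_distrib, map_neg]
  rw [h]
  ring

/-- As the Hessian is symmetric, its rough Laplacian is a divergence in the second index, to which
`div2_cov` applies. -/
lemma rough_diff (u : A) : g.rough (g.diff u) = g.diff (g.lap u) + g.ric *ᵥ (g.H *ᵥ g.diff u) := by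
  ext j
  rw [Pi.add_apply, rough_apply]
  refine Eq.trans ?_ (g.div2_cov (g.diff u) j)
  refine Finset.sum_congr rfl fun k _ => Finset.sum_congr rfl fun i _ => ?_
  conv_lhs => rw [← g.cov_diff_symm u, cov2_transpose, transpose_apply]

/-! ### Gradient solitons -/

/-- The gradient `η`-Ricci soliton equation, with `L_ξ g` written as twice the Hessian. -/
def IsSoliton (u : A) (lam mu : ℝ) : Prop :=
  g.cov (g.diff u) + g.ric + lam • g.G + mu • vecMulVec (g.diff u) (g.diff u) = 0

variable {g} {u : A} {lam mu : ℝ}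

/-- The soliton equation writes Ricci in terms of symmetric tensors, so the first Bianchi identity
is not needed. -/
lemma IsSoliton.ric_symm (h : g.IsSoliton u lam mu) : g.ricᵀ = g.ric := by
  have e : g.ric = -(g.cov (g.diff u) + lam • g.G + mu • vecMulVec (g.diff u) (g.diff u)) := by
    rw [eq_neg_iff_add_eq_zero, ← show _ = (0 : Matrix (Fin n) (Fin n) A) from h]
    abel
  rw [e]
  simp only [transpose_neg, transpose_add, transpose_smul, transpose_vecMulVec, g.G_symm,
    g.cov_diff_symm]

lemma IsSoliton.trace_eq (h : g.IsSoliton u lam mu) (k : Fin n) :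
    g.D k (g.lap u) + g.D k (g.tr g.ric) + mu • (2 * g.inner (g.cov1 k (g.diff u)) (g.diff u))
      = 0 := by
  have h1 := congrArg (fun T => g.tr (g.cov2 k T)) h
  simp only [cov2_add, cov2_smul, cov2_G, cov2_zero, tr_add, tr_smul, ← D_tr, tr_vecMulVec,
    D_inner, g.inner_comm (g.diff u)] at h1
  have h0 : g.tr 0 = 0 := by simp [tr]
  rw [h0, smul_zero, add_zero, ← two_mul] at h1
  exact h1

lemma IsSoliton.div_eq (h : g.IsSoliton u lam mu) (k : Fin n) :
    g.D k (g.lap u) + (g.ric *ᵥ (g.H *ᵥ g.diff u)) k + g.div2 g.ric k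
      + mu • (g.inner (g.cov1 k (g.diff u)) (g.diff u) + g.lap u * g.diff u k) = 0 := by
  have h1 := congrArg (fun T => g.div2 T k) h
  have hadd : ∀ S T, g.div2 (S + T) k = g.div2 S k + g.div2 T k := by
    intro S T
    simp only [div2, cov2_add, Matrix.add_apply, mul_add, Finset.sum_add_distrib]
  have hsmul : ∀ (c : ℝ) T, g.div2 (c • T) k = c • g.div2 T k := by
    intro c T
    simp only [div2, cov2_smul, Matrix.smul_apply, mul_smul_comm, Finset.smul_sum]
  have hv : g.div2 (vecMulVec (g.diff u) (g.diff u)) k =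
      g.inner (g.cov1 k (g.diff u)) (g.diff u) + g.lap u * g.diff u k := by
    rw [lap, tr_eq_sum, div2]
    simp only [cov2_vecMulVec, Matrix.add_apply, vecMulVec_apply, mul_add, Finset.sum_add_distrib]
    congr 1
    · simp only [inner, mulVec, dotProduct, Finset.mul_sum]
      refine Finset.sum_congr rfl fun j _ => Finset.sum_congr rfl fun m _ => ?_
      have : g.cov1 j (g.diff u) k = g.cov1 k (g.diff u) j :=
        congrFun (congrFun (g.cov_diff_symm u) k) j
      rw [this]; ring
    · simp only [Finset.sum_mul]
      refine Finset.sum_congr rfl fun j _ => Finset.sum_congr rfl fun m _ => ?_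
      rw [cov, of_apply]; ring
  have h0 : g.div2 0 k = 0 := by simp [div2, cov2_zero]
  have hG : g.div2 g.G k = 0 := by simp [div2, cov2_G]
  simp only [hadd, hsmul, hv, h0, hG, div2_cov, smul_zero, add_zero] at h1
  exact h1

/-- In twice the divergence minus the trace, Bianchi removes the scalar curvature and the `d|du|²`
terms cancel. -/
lemma IsSoliton.diff_lap (h : g.IsSoliton u lam mu) :
    g.diff (g.lap u) + (2 : A) • (g.ric *ᵥ (g.H *ᵥ g.diff u)) =
      -((2 * mu • g.lap u) • g.diff u) := by
  ext k
  have h1 := h.trace_eq k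
  have h2 := h.div_eq k
  have h3 : g.D k (g.tr g.ric) = 2 * g.div2 g.ric k := g.contracted_bianchi k
  simp only [Pi.add_apply, Pi.neg_apply, Pi.smul_apply, smul_eq_mul]
  simp only [Algebra.smul_def] at h1 h2 ⊢
  change g.D k (g.lap u) + _ = _
  linear_combination 2 * h2 - h1 + h3

theorem IsSoliton.lap_inner (h : g.IsSoliton u lam mu) (c : Fin n → A) :
    g.lap (g.inner (g.diff u) c) = 2 * g.inner2 (g.cov (g.diff u)) (g.cov c)
      - 2 * (mu • g.lap u) * g.inner (g.diff u) c + g.inner (g.diff u) (g.hodge c) := by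
  have hs : g.inner (g.ric *ᵥ (g.H *ᵥ c)) (g.diff u) =
      g.inner (g.ric *ᵥ (g.H *ᵥ g.diff u)) c := by
    rw [inner, inner, ← h.ric_symm, mulVec_transpose, ← dotProduct_mulVec, h.ric_symm,
      dotProduct_comm]
  have h1 := congrArg (fun v => g.inner v c) h.diff_lap
  rw [← neg_smul] at h1
  simp only [inner_add_left, inner_smul_left] at h1
  rw [g.lap_inner, g.inner_comm (g.diff u) (g.hodge c), hodge_eq, inner_sub_left, hs, rough_diff,
    inner_add_left]
  linear_combination h1

/-- The divergence of the gradient. -/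
lemma sum_D_grad (g : CoordinateMetric n A) (u : A) :
    ∑ i, (g.D i ((g.H *ᵥ g.diff u) i) + ∑ k, g.chr i i k * (g.H *ᵥ g.diff u) k) = g.lap u := by
  rw [lap, tr_eq_sum]
  refine Finset.sum_congr rfl fun i _ => ?_
  have := congrFun (g.dVec_H_mulVec i (g.diff u)) i
  rw [Pi.sub_apply] at this
  exact (eq_sub_iff_add_eq.mp this)

/-- The Lie derivative of the metric along a gradient is twice the Hessian. -/
lemma lie_grad (g : CoordinateMetric n A) (u : A) (i j : Fin n) :
    ∑ k, ((g.H *ᵥ g.diff u) k * g.D k (g.G i j) + g.G k j * g.D i ((g.H *ᵥ g.diff u) k)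
      + g.G i k * g.D j ((g.H *ᵥ g.diff u) k)) = 2 * g.cov (g.diff u) i j := by
  have hG : g.G *ᵥ (g.H *ᵥ g.diff u) = g.diff u := by
    rw [mulVec_mulVec, g.G_mul_H, one_mulVec]
  set X := g.H *ᵥ g.diff u with hX
  -- Differentiating `G X = du` trades derivatives of `X` for second derivatives of `u`.
  have h1 : ∀ i j, ∑ k, g.G j k * g.D i (X k) =
      g.D i (g.diff u j) - ∑ k, g.D i (g.G j k) * X k := by
    intro i j
    have := congrFun (g.dVec_mulVec i g.G X) j
    rw [hG] at this
    exact (sub_eq_of_eq_add' this).symm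
  have h2 : ((g.conn i)ᵀ *ᵥ g.diff u) j = (X ᵥ* (g.G * g.conn i)) j := by
    rw [← hG, mulVec_transpose, ← vecMul_vecMul, ← mulVec_transpose g.G, g.G_symm]
  have h3 : 2 * (X ᵥ* (g.G * g.conn i)) j =
      ∑ k, X k * (g.D i (g.G j k) + g.D j (g.G i k) - g.D k (g.G i j)) := by
    rw [vecMul, dotProduct, Finset.mul_sum]
    refine Finset.sum_congr rfl fun k _ => ?_
    rw [G_mul_conn_apply, mul_left_comm, two_mul, ← add_smul]
    norm_num
  simp only [Finset.sum_add_distrib, g.G_apply_comm _ j, h1, cov, of_apply, cov1, Pi.sub_apply, h2]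
  rw [mul_sub, h3]
  simp only [mul_add, mul_sub, Finset.sum_add_distrib, Finset.sum_sub_distrib, dVec, diff,
    g.D_comm j i, mul_comm _ (X _), g.G_apply_comm j i]
  ring

end CoordinateMetric

end

noncomputable section

open TopologicalSpace

namespace EtaRicci

variable {n : ℕ} {U : Opens (Coord n)}

/-! ### The algebra of smooth functions on an open set of coordinate space -/

lemma pd_eqOn {v w : Coord n → ℝ} (h : Set.EqOn v w U) (i : Fin n) :
    Set.EqOn (pd i v) (pd i w) U := fun y hy => by
  have : v =ᶠ[nhds y] w := Filter.eventuallyEq_of_mem (U.isOpen.mem_nhds hy) h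
  simp only [pd, this.fderiv_eq]

lemma contDiffOn_pd {v : Coord n → ℝ} (h : ContDiffOn ℝ ∞ v U) (i : Fin n) :
    ContDiffOn ℝ ∞ (pd i v) U :=
  (h.fderiv_of_isOpen U.isOpen (m := ∞) le_rfl).clm_apply contDiffOn_const

lemma pd_comm {v : Coord n → ℝ} (h : ContDiffOn ℝ ∞ v U) (i j : Fin n) {y : Coord n}
    (hy : y ∈ U) : pd i (pd j v) y = pd j (pd i v) y := by
  have hv : ContDiffAt ℝ ∞ v y := h.contDiffAt (U.isOpen.mem_nhds hy)
  have hd : DifferentiableAt ℝ (fderiv ℝ v) y :=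
    (hv.fderiv_right (m := 1) (by norm_cast)).differentiableAt one_ne_zero
  have key : ∀ i j, pd i (pd j v) y =
      fderiv ℝ (fderiv ℝ v) y (EuclideanSpace.single i 1) (EuclideanSpace.single j 1) := by
    intro i j
    unfold pd
    rw [fderiv_clm_apply hd (differentiableAt_const _)]
    simp
  rw [key, key]
  exact (hv.isSymmSndFDerivAt (by simp; norm_cast)) _ _

/-- Smooth functions on the open set `U`. -/
def smoothOn (U : Opens (Coord n)) : Subalgebra ℝ (U → ℝ) where
  carrier := {u | ∃ v : Coord n → ℝ, ContDiffOn ℝ ∞ v U ∧ ∀ y : U, v y = u y}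
  mul_mem' := by
    rintro _ _ ⟨v, hv, h⟩ ⟨w, hw, h'⟩
    exact ⟨fun y => v y * w y, hv.mul hw, fun y => by simp [h, h']⟩
  add_mem' := by
    rintro _ _ ⟨v, hv, h⟩ ⟨w, hw, h'⟩
    exact ⟨fun y => v y + w y, hv.add hw, fun y => by simp [h, h']⟩
  algebraMap_mem' r := ⟨fun _ => r, contDiffOn_const, fun _ => rfl⟩

/-- Evaluation at a point. -/
def evalAt (y : U) : smoothOn U →ₐ[ℝ] ℝ :=
  (Pi.evalAlgHom ℝ (fun _ : U => ℝ) y).comp (smoothOn U).val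

lemma smoothOn_ext {a b : smoothOn U} (h : ∀ y, evalAt y a = evalAt y b) : a = b :=
  Subtype.ext (funext h)

/-- The function `v` represents the smooth function `a` on `U`. -/
def Represents (v : Coord n → ℝ) (a : smoothOn U) : Prop := ∀ y : U, v y = evalAt y a

/-- A smooth function on `U`, as a function on coordinate space. -/
def lift (a : smoothOn U) : Coord n → ℝ := a.2.choose

lemma contDiffOn_lift (a : smoothOn U) : ContDiffOn ℝ ∞ (lift a) U := a.2.choose_spec.1

lemma represents_lift (a : smoothOn U) : Represents (lift a) a := a.2.choose_spec.2

/-- The restriction to `U` of a function that is smooth on `U`. -/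
def restr (v : Coord n → ℝ) (hv : ContDiffOn ℝ ∞ v U) : smoothOn U :=
  ⟨fun y => v y, v, hv, fun _ => rfl⟩

lemma represents_restr (v : Coord n → ℝ) (hv : ContDiffOn ℝ ∞ v U) :
    Represents v (restr v hv) := fun _ => rfl

/-- Since `U` is open, derivatives on `U` ignore values outside it; this makes the choice in `lift`
harmless. -/
lemma Represents.pd_eq {v w : Coord n → ℝ} {a : smoothOn U} (hv : Represents v a)
    (hw : Represents w a) (i : Fin n) (y : U) : pd i v y = pd i w y :=
  pd_eqOn (fun y hy => (hv ⟨y, hy⟩).trans (hw ⟨y, hy⟩).symm) i y.2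

lemma Represents.contDiffOn {v : Coord n → ℝ} {a : smoothOn U} (hv : Represents v a) :
    ContDiffOn ℝ ∞ v U :=
  (contDiffOn_lift a).congr fun y hy => (hv ⟨y, hy⟩).trans (represents_lift a ⟨y, hy⟩).symm

lemma Represents.differentiableAt {v : Coord n → ℝ} {a : smoothOn U} (hv : Represents v a)
    (y : U) : DifferentiableAt ℝ v y :=
  (hv.contDiffOn.contDiffAt (U.isOpen.mem_nhds y.2)).differentiableAt (by simp)

lemma Represents.add {v w : Coord n → ℝ} {a b : smoothOn U} (hv : Represents v a)
    (hw : Represents w b) : Represents (fun y => v y + w y) (a + b) := fun y => by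
  rw [map_add, ← hv, ← hw]

lemma Represents.mul {v w : Coord n → ℝ} {a b : smoothOn U} (hv : Represents v a)
    (hw : Represents w b) : Represents (fun y => v y * w y) (a * b) := fun y => by
  rw [map_mul, ← hv, ← hw]

lemma Represents.const_smul {v : Coord n → ℝ} {a : smoothOn U} (c : ℝ) (hv : Represents v a) :
    Represents (fun y => c * v y) (c • a) := fun y => by
  rw [map_smul, ← hv, smul_eq_mul]

/-- The partial derivatives as derivations of the algebra of smooth functions on `U`. -/
def pdDer (U : Opens (Coord n)) (i : Fin n) : Derivation ℝ (smoothOn U) (smoothOn U) :=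
  Derivation.mk'
    { toFun := fun a => restr (pd i (lift a)) (contDiffOn_pd (contDiffOn_lift a) i)
      map_add' := fun a b => smoothOn_ext fun y => by
        have h := (represents_lift a).add (represents_lift b)
        rw [map_add, ← represents_restr _ _ y, ← represents_restr _ _ y, ← represents_restr _ _ y,
          (represents_lift (a + b)).pd_eq h]
        unfold pd
        rw [fderiv_fun_add ((represents_lift a).differentiableAt y)
          ((represents_lift b).differentiableAt y)]
        rfl
      map_smul' := fun c a => smoothOn_ext fun y => by
        have h := (represents_lift a).const_smul c
        rw [RingHom.id_apply, map_smul, ← represents_restr _ _ y, ← represents_restr _ _ y,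
          (represents_lift (c • a)).pd_eq h]
        unfold pd
        rw [fderiv_const_mul ((represents_lift a).differentiableAt y)]
        rfl }
    (fun a b => smoothOn_ext fun y => by
      have h := (represents_lift a).mul (represents_lift b)
      change pd i (lift (a * b)) y = evalAt y a * pd i (lift b) y + evalAt y b * pd i (lift a) y
      rw [(represents_lift (a * b)).pd_eq h, ← represents_lift a, ← represents_lift b]
      unfold pd
      rw [fderiv_fun_mul ((represents_lift a).differentiableAt y)
        ((represents_lift b).differentiableAt y)]
      simp)

lemma Represents.pd {v : Coord n → ℝ} {a : smoothOn U} (hv : Represents v a) (i : Fin n) :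
    Represents (pd i v) (pdDer U i a) := fun y => hv.pd_eq (represents_lift a) i y

lemma pdDer_comm (i j : Fin n) (a : smoothOn U) :
    pdDer U i (pdDer U j a) = pdDer U j (pdDer U i a) := smoothOn_ext fun y => by
  rw [← ((represents_lift a).pd j).pd i y, ← ((represents_lift a).pd i).pd j y]
  exact pd_comm (contDiffOn_lift a) i j y.2

/-- Applied to `det G`, this makes the inverse metric exist over the algebra. -/
lemma isUnit_smoothOn {a : smoothOn U} (h : ∀ y, evalAt y a ≠ 0) : IsUnit a := by
  have hl : ∀ y ∈ U, lift a y ≠ 0 := fun y hy => by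
    rw [represents_lift a ⟨y, hy⟩]; exact h _
  refine IsUnit.of_mul_eq_one (restr (fun y => (lift a y)⁻¹) ((contDiffOn_lift a).inv hl))
    (smoothOn_ext fun y => ?_)
  rw [map_mul, map_one, ← represents_restr _ _ y, represents_lift a y]
  exact mul_inv_cancel₀ (h y)

/-! ### Coordinate expressions in the algebra of smooth functions -/

/-- The metric `g` on the algebra of smooth functions on `U` has the components `G`. -/
structure IsMetricOn (g : CoordinateMetric n (smoothOn U)) (G : Tensor2 n) : Prop where
  D_eq : g.D = pdDer U
  G_eq : ∀ i j, Represents (G i j) (g.G i j)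

lemma exists_isMetricOn {G : Tensor2 n} (hG : ∀ i j, ContDiffOn ℝ ∞ (G i j) U)
    (hsymm : ∀ y ∈ U, ∀ i j, G i j y = G j i y)
    (hdet : ∀ y ∈ U, (Matrix.of fun i j => G i j y).det ≠ 0) :
    ∃ g : CoordinateMetric n (smoothOn U), IsMetricOn g G := by
  let K : Matrix (Fin n) (Fin n) (smoothOn U) := Matrix.of fun i j => restr (G i j) (hG i j)
  have hK : IsUnit K.det := isUnit_smoothOn fun y => by
    rw [AlgHom.map_det]
    exact hdet y y.2
  exact ⟨⟨pdDer U, pdDer_comm, K, K⁻¹,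
    Matrix.ext fun i j => smoothOn_ext fun y => hsymm y y.2 j i,
    Matrix.mul_nonsing_inv K hK⟩, rfl, fun i j => represents_restr _ (hG i j)⟩

namespace IsMetricOn

variable {g : CoordinateMetric n (smoothOn U)} {G : Tensor2 n}

lemma pd (hg : IsMetricOn g G)
    {v : Coord n → ℝ} {a : smoothOn U} (hv : Represents v a) (i : Fin n) :
    Represents (EtaRicci.pd i v) (g.D i a) := by
  rw [hg.D_eq]; exact hv.pd i

lemma inv (hg : IsMetricOn g G) (i j : Fin n) : Represents (inv G i j) (g.H i j) := fun y => by
  have h : (g.H.map (evalAt y)) * (Matrix.of fun a b => G a b y) = 1 := by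
    have := congrArg (fun T => T.map (evalAt y)) g.H_mul_G
    rw [Matrix.map_mul, Matrix.map_one _ (map_zero _) (map_one _)] at this
    rw [← this]
    congr 1
    ext a b
    exact hg.G_eq a b y
  rw [EtaRicci.inv, Matrix.inv_eq_left_inv h]
  rfl

lemma christoffel (hg : IsMetricOn g G)
    (k i j : Fin n) : Represents (christoffel G k i j) (g.chr k i j) := fun y => by
  simp only [EtaRicci.christoffel, CoordinateMetric.chr, map_smul, map_sum, map_mul, map_sub,
    map_add, smul_eq_mul, hg.inv _ _ y, hg.pd (hg.G_eq _ _) _ y]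

lemma riemann (hg : IsMetricOn g G)
    (l i j k : Fin n) : Represents (riemann G l i j k) (g.curv i j l k) := fun y => by
  simp only [EtaRicci.riemann, CoordinateMetric.curv, Matrix.sub_apply, Matrix.add_apply,
    Matrix.mul_apply, CoordinateMetric.dMat_apply, CoordinateMetric.conn_apply, map_sum, map_mul,
    map_sub, map_add, hg.christoffel _ _ _ y, hg.pd (hg.christoffel _ _ _) _ y,
    Finset.sum_sub_distrib]
  ring

lemma ricci (hg : IsMetricOn g G)
    (i j : Fin n) : Represents (ricci G i j) (g.ric i j) := fun y => by
  simp only [EtaRicci.ricci, CoordinateMetric.ric, Matrix.of_apply, map_sum,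
    hg.riemann _ _ _ _ y]

lemma dFun (hg : IsMetricOn g G)
    {v : Coord n → ℝ} {u : smoothOn U} (hv : Represents v u) (i : Fin n) :
    Represents (dFun v i) (g.diff u i) := hg.pd hv i

lemma grad (hg : IsMetricOn g G)
    {v : Coord n → ℝ} {u : smoothOn U} (hv : Represents v u) (i : Fin n) :
    Represents (grad G v i) (g.H.mulVec (g.diff u) i) := fun y => by
  simp only [EtaRicci.grad, Matrix.mulVec, dotProduct, CoordinateMetric.diff, map_sum, map_mul,
    hg.inv _ _ y, hg.pd hv _ y]

lemma flat_grad (hg : IsMetricOn g G)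
    {v : Coord n → ℝ} {u : smoothOn U} (hv : Represents v u) (i : Fin n) :
    Represents (flat G (EtaRicci.grad G v) i) (g.diff u i) := fun y => by
  have h : g.diff u = g.G.mulVec (g.H.mulVec (g.diff u)) := by
    rw [Matrix.mulVec_mulVec, g.G_mul_H, Matrix.one_mulVec]
  rw [h]
  simp only [flat, Matrix.mulVec, dotProduct, map_sum, map_mul, hg.G_eq _ _ y, hg.grad hv _ y]

lemma laplacian (hg : IsMetricOn g G) {v : Coord n → ℝ} {u : smoothOn U} (hv : Represents v u) :
    Represents (laplacian G v) (g.lap u) := fun y => by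
  simp only [EtaRicci.laplacian, divVec, ← g.sum_D_grad, map_sum, map_mul, map_add,
    hg.christoffel _ _ _ y, hg.grad hv _ y, hg.pd (hg.grad hv _) _ y]

lemma lieMetric_grad (hg : IsMetricOn g G)
    {v : Coord n → ℝ} {u : smoothOn U} (hv : Represents v u) (i j : Fin n) :
    Represents (lieMetric G (EtaRicci.grad G v) i j) (2 * g.cov (g.diff u) i j) := fun y => by
  simp only [lieMetric, ← g.lie_grad, map_sum, map_mul, map_add, hg.G_eq _ _ y,
    hg.pd (hg.G_eq _ _) _ y, hg.grad hv _ y, hg.pd (hg.grad hv _) _ y]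

lemma nabla (hg : IsMetricOn g G)
    {c : Tensor1 n} {a : Fin n → smoothOn U} (hc : ∀ i, Represents (c i) (a i))
    (i j : Fin n) : Represents (nabla G c i j) (g.cov a i j) := fun y => by
  simp only [EtaRicci.nabla, CoordinateMetric.cov, CoordinateMetric.cov1, Matrix.of_apply,
    Pi.sub_apply, CoordinateMetric.dVec, Matrix.mulVec, dotProduct, Matrix.transpose_apply,
    CoordinateMetric.conn_apply, map_sub, map_sum, map_mul, hg.christoffel _ _ _ y, hc _ y,
    hg.pd (hc _) _ y]

lemma nabla2 (hg : IsMetricOn g G) {T : Tensor2 n} {t : Matrix (Fin n) (Fin n) (smoothOn U)}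
    (hT : ∀ i j, Represents (T i j) (t i j)) (k i j : Fin n) :
    Represents (nabla2 G T k i j) (g.cov2 k t i j) := fun y => by
  simp only [EtaRicci.nabla2, CoordinateMetric.cov2, Matrix.sub_apply, Matrix.mul_apply,
    CoordinateMetric.dMat_apply, Matrix.transpose_apply, CoordinateMetric.conn_apply, map_sub,
    map_sum, map_mul, hg.christoffel _ _ _ y, hT _ _ y, hg.pd (hT _ _) _ y,
    Finset.sum_add_distrib, mul_comm (evalAt y (t _ _))]
  ring

lemma inner1 (hg : IsMetricOn g G)
    {b c : Tensor1 n} {a d : Fin n → smoothOn U} (hb : ∀ i, Represents (b i) (a i))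
    (hc : ∀ i, Represents (c i) (d i)) : Represents (inner1 G b c) (g.inner a d) := fun y => by
  simp only [EtaRicci.inner1, CoordinateMetric.inner, Matrix.mulVec, dotProduct, map_sum, map_mul,
    hg.inv _ _ y, hb _ y, hc _ y, Finset.mul_sum]
  exact Finset.sum_congr rfl fun i _ => Finset.sum_congr rfl fun j _ => by ring

lemma inner2 (hg : IsMetricOn g G) {T V : Tensor2 n} {t v : Matrix (Fin n) (Fin n) (smoothOn U)}
    (hT : ∀ i j, Represents (T i j) (t i j)) (hV : ∀ i j, Represents (V i j) (v i j)) :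
    Represents (inner2 G T V) (g.inner2 t v) := fun y => by
  simp only [EtaRicci.inner2, CoordinateMetric.inner2, CoordinateMetric.inner, Matrix.mulVec,
    dotProduct, map_sum, map_mul, hg.inv _ _ y, hT _ _ y, hV _ _ y, Finset.mul_sum]
  refine Finset.sum_congr rfl fun i _ => ?_
  rw [Finset.sum_comm]
  exact Finset.sum_congr rfl fun k _ => Finset.sum_congr rfl fun j _ =>
    Finset.sum_congr rfl fun l _ => by ring

lemma codiff1 (hg : IsMetricOn g G)
    {c : Tensor1 n} {a : Fin n → smoothOn U} (hc : ∀ i, Represents (c i) (a i)) :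
    Represents (codiff1 G c) (-g.tr (g.cov a)) := fun y => by
  simp only [EtaRicci.codiff1, g.tr_eq_sum, map_neg, map_sum, map_mul, hg.inv _ _ y,
    hg.nabla hc _ _ y]

lemma dForm (hg : IsMetricOn g G)
    {c : Tensor1 n} {a : Fin n → smoothOn U} (hc : ∀ i, Represents (c i) (a i))
    (i j : Fin n) : Represents (dForm c i j) ((g.cov a - (g.cov a).transpose) i j) := fun y => by
  simp only [EtaRicci.dForm, g.cov_sub_transpose, Matrix.of_apply, map_sub, hg.pd (hc _) _ y]

lemma codiff2 (hg : IsMetricOn g G) {w : Tensor2 n} {t : Matrix (Fin n) (Fin n) (smoothOn U)}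
    (hw : ∀ i j, Represents (w i j) (t i j)) (j : Fin n) :
    Represents (codiff2 G w j) (g.codiff2 t j) := fun y => by
  simp only [EtaRicci.codiff2, CoordinateMetric.codiff2, map_neg, map_sum, map_mul, hg.inv _ _ y,
    hg.nabla2 hw _ _ _ y]

lemma hodgeLaplacian (hg : IsMetricOn g G) {c : Tensor1 n} {a : Fin n → smoothOn U}
    (hc : ∀ i, Represents (c i) (a i)) (i : Fin n) :
    Represents (hodgeLaplacian G c i) (g.hodge a i) := fun y => by
  simp only [EtaRicci.hodgeLaplacian, CoordinateMetric.hodge, map_neg, map_add]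
  rw [hg.dFun (hg.codiff1 hc) i y, hg.codiff2 (hg.dForm hc) i y]
  simp [CoordinateMetric.diff]

end IsMetricOn

/-- The Bochner type formula for gradient `η`-Ricci solitons on a coordinate domain. -/
theorem bochner_of_soliton_on {G : Tensor2 n} {F : Coord n → ℝ} {c : Tensor1 n} {lam mu : ℝ}
    (hG : ∀ i j, ContDiffOn ℝ ∞ (G i j) U) (hsymm : ∀ y ∈ U, ∀ i j, G i j y = G j i y)
    (hdet : ∀ y ∈ U, (Matrix.of fun i j => G i j y).det ≠ 0) (hF : ContDiffOn ℝ ∞ F U)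
    (hc : ∀ i, ContDiffOn ℝ ∞ (c i) U)
    (hsol : ∀ y ∈ U, ∀ i j, lieMetric G (grad G F) i j y + 2 * ricci G i j y + 2 * lam * G i j y
      + 2 * mu * (flat G (grad G F) i y * flat G (grad G F) j y) = 0) {y : Coord n} (hy : y ∈ U) :
    (1 / 2) * laplacian G (inner1 G (dFun F) c) y = inner2 G (hess G F) (nabla G c) y
      - mu * laplacian G F y * inner1 G (dFun F) c y
      + (1 / 2) * inner1 G (dFun F) (hodgeLaplacian G c) y := by
  obtain ⟨g, hg⟩ := exists_isMetricOn hG hsymm hdet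
  have hu := represents_restr F hF
  set u := restr F hF
  have ha := fun i => represents_restr (c i) (hc i)
  set a : Fin n → smoothOn U := fun i => restr (c i) (hc i)
  -- The Lie derivative is twice the Hessian, so this is half of the given equation.
  have h : g.IsSoliton u lam mu := by
    refine Matrix.ext fun i j => smoothOn_ext fun y => ?_
    have := hsol y y.2 i j
    rw [hg.lieMetric_grad hu i j y, hg.ricci i j y, hg.G_eq i j y, hg.flat_grad hu i y,
      hg.flat_grad hu j y] at this
    simp only [Matrix.add_apply, Matrix.smul_apply, Matrix.vecMulVec_apply, map_add, map_smul,
      map_mul, smul_eq_mul, Matrix.zero_apply, map_zero, map_ofNat] at this ⊢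
    linarith
  have hd := hg.dFun hu
  have key := congrArg (evalAt ⟨y, hy⟩) (h.lap_inner a)
  simp only [map_add, map_sub, map_mul, map_smul, smul_eq_mul, map_ofNat] at key
  rw [hg.laplacian (hg.inner1 hd ha) ⟨y, hy⟩, hess, hg.inner2 (hg.nabla hd) (hg.nabla ha) ⟨y, hy⟩,
    hg.laplacian hu ⟨y, hy⟩, hg.inner1 hd ha ⟨y, hy⟩,
    hg.inner1 hd (hg.hodgeLaplacian ha) ⟨y, hy⟩]
  linarith

end EtaRicci

end

noncomputable section

namespace EtaRicci

variable {n : ℕ} {M : Type*} [TopologicalSpace M] [ChartedSpace (Coord n) M]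
  {e : OpenPartialHomeomorph M (Coord n)}

/-! ### Smoothness of components in a chart -/

lemma contDiffOn_funIn (he : e ∈ IsManifold.maximalAtlas (𝓡 n) ∞ M) {f : M → ℝ}
    (hf : ContMDiff (𝓡 n) 𝓘(ℝ) ∞ f) : ContDiffOn ℝ ∞ (funIn e f) e.target := by
  rw [← contMDiffOn_iff_contDiffOn]
  exact hf.comp_contMDiffOn (contMDiffOn_symm_of_mem_maximalAtlas he)

variable [IsManifold (𝓡 n) ∞ M]

/-- The coordinate field is the tangent map of the smooth `e.symm` applied to a constant field. -/
lemma contMDiffOn_coordVec (he : e ∈ IsManifold.maximalAtlas (𝓡 n) ∞ M) (i : Fin n) :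
    ContMDiffOn (𝓡 n) ((𝓡 n).prod (𝓡 n)) ∞
      (fun y => Bundle.TotalSpace.mk' (Coord n) (E := fun p : M => TangentSpace (𝓡 n) p)
        (e.symm y) (coordVec e i y)) e.target := by
  have : IsManifold (𝓡 n) 1 M := IsManifold.of_le (n := ∞) (by norm_cast)
  have h1 := contMDiffOn_symm_of_mem_maximalAtlas he
  have h2 := h1.contMDiffOn_tangentMapWithin (m := ∞) le_rfl e.open_target.uniqueMDiffOn
  have h3 : ContMDiffOn (𝓡 n) ((𝓡 n).prod (𝓡 n)) ∞
      (fun y : Coord n => (⟨y, (EuclideanSpace.single i (1 : ℝ) : Coord n)⟩ :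
        TangentBundle (𝓡 n) (Coord n))) e.target :=
    contMDiffOn_vectorSpace_iff_contDiffOn.2 contDiffOn_const
  refine (h2.comp h3 fun y hy => hy).congr fun y hy => ?_
  simp only [Function.comp, tangentMapWithin, coordVec, mfderivWithin_of_isOpen e.open_target hy]

lemma contDiffOn_metricIn (he : e ∈ IsManifold.maximalAtlas (𝓡 n) ∞ M) (g : Metric n M)
    (i j : Fin n) : ContDiffOn ℝ ∞ (metricIn e g i j) e.target := by
  have h := ContMDiffOn.clm_bundle_apply₂ (F₁ := Coord n) (F₂ := Coord n) (F₃ := ℝ)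
    (E₃ := Bundle.Trivial M ℝ)
    (g.contMDiff.comp_contMDiffOn (contMDiffOn_symm_of_mem_maximalAtlas he))
    (contMDiffOn_coordVec he i) (contMDiffOn_coordVec he j)
  rw [← contMDiffOn_iff_contDiffOn]
  intro y hy
  have := h y hy
  simp only [Bundle.contMDiffWithinAt_totalSpace] at this
  exact this.2

lemma contDiffOn_formIn (he : e ∈ IsManifold.maximalAtlas (𝓡 n) ∞ M) {a : OneForm n M}
    (ha : a.IsSmooth) (i : Fin n) : ContDiffOn ℝ ∞ (formIn e a i) e.target := by
  rw [OneForm.IsSmooth] at ha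
  have h0 := ha.comp_contMDiffOn (contMDiffOn_symm_of_mem_maximalAtlas he)
  have h := ContMDiffOn.clm_bundle_apply (F₁ := Coord n) (F₂ := ℝ)
    (E₂ := Bundle.Trivial M ℝ) h0
    (contMDiffOn_coordVec he i)
  rw [← contMDiffOn_iff_contDiffOn]
  intro y hy
  have := h y hy
  simp only [Bundle.contMDiffWithinAt_totalSpace] at this
  exact this.2

/-- A kernel vector of the Gram matrix would give a tangent vector of zero length, nonzero because
the differential of `e.symm` is injective. -/
lemma det_metricIn_ne_zero (he : e ∈ IsManifold.maximalAtlas (𝓡 n) ∞ M) (g : Metric n M)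
    {y : Coord n} (hy : y ∈ e.target) :
    (Matrix.of fun i j => metricIn e g i j y).det ≠ 0 := by
  intro h0
  obtain ⟨v, hv, hGv⟩ := Matrix.exists_mulVec_eq_zero_iff.mpr h0
  have hd : e.MDifferentiable (𝓡 n) (𝓡 n) :=
    ⟨(contMDiffOn_of_mem_maximalAtlas he).mdifferentiableOn (by simp),
      (contMDiffOn_symm_of_mem_maximalAtlas he).mdifferentiableOn (by simp)⟩
  set w : Coord n := WithLp.toLp 2 v with hw
  have hsum : w = ∑ i, v i • EuclideanSpace.single i (1 : ℝ) := by
    ext k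
    simp [hw, Finset.sum_apply, Pi.single_apply]
  set L := mfderiv (𝓡 n) (𝓡 n) e.symm y with hL
  have hLw : L w = ∑ i, v i • coordVec e i y := by
    rw [hsum]
    exact (map_sum L _ _).trans (Finset.sum_congr rfl fun i _ => map_smul L _ _)
  have hw0 : w ≠ 0 := fun h => hv (by simpa [hw] using h)
  have hLw0 : L w ≠ 0 := fun h =>
    hw0 (hd.symm.mfderiv_injective hy (h.trans (map_zero L).symm))
  have hpos := g.pos (e.symm y) (L w) hLw0
  have hzero : g.inner (e.symm y) (L w) (L w) = 0 := by
    have e1 : ∀ i, g.inner (e.symm y) (coordVec e i y) (L w) = 0 := by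
      intro i
      have := congrFun hGv i
      simp only [Matrix.mulVec, dotProduct, Matrix.of_apply, metricIn, Pi.zero_apply] at this
      rw [hLw, map_sum, ← this]
      refine Finset.sum_congr rfl fun j _ => ?_
      rw [map_smul, smul_eq_mul, mul_comm]
    rw [g.symm]
    conv_lhs => arg 2; rw [hLw]
    rw [map_sum]
    refine Finset.sum_eq_zero fun i _ => ?_
    rw [map_smul, g.symm, e1, smul_zero]
  exact hpos.ne' hzero

end EtaRicci

end

theorem mainTheorem11 {n : ℕ} {M : Type*} [TopologicalSpace M]
    [ChartedSpace (EuclideanSpace ℝ (Fin n)) M] [IsManifold (𝓡 n) ∞ M]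
    (g : EtaRicci.Metric n M) (f : M → ℝ) (hf : ContMDiff (𝓡 n) 𝓘(ℝ) ∞ f) (lam mu : ℝ)
    (hsol : EtaRicci.IsGradientEtaRicciSoliton g f lam mu)
    (γ : EtaRicci.OneForm n M) (hγ : γ.IsSmooth)
    (e : OpenPartialHomeomorph M (EuclideanSpace ℝ (Fin n)))
    (he : e ∈ IsManifold.maximalAtlas (𝓡 n) ∞ M) (p : M) (hp : p ∈ e.source) :
    let G := EtaRicci.metricIn e g
    let F := EtaRicci.funIn e f
    let c := EtaRicci.formIn e γ
    (1 / 2) * EtaRicci.laplacian G (EtaRicci.inner1 G (EtaRicci.dFun F) c) (e p) =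
      EtaRicci.inner2 G (EtaRicci.hess G F) (EtaRicci.nabla G c) (e p)
        - mu * EtaRicci.laplacian G F (e p) * EtaRicci.inner1 G (EtaRicci.dFun F) c (e p)
        + (1 / 2) * EtaRicci.inner1 G (EtaRicci.dFun F) (EtaRicci.hodgeLaplacian G c) (e p) := by
  exact EtaRicci.bochner_of_soliton_on (U := ⟨e.target, e.open_target⟩)
    (EtaRicci.contDiffOn_metricIn he g) (fun y _ i j => g.symm _ _ _)
    (fun y hy => EtaRicci.det_metricIn_ne_zero he g hy) (EtaRicci.contDiffOn_funIn he hf)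
    (EtaRicci.contDiffOn_formIn he hγ) (fun y hy i j => hsol e he y hy i j) (e.map_source hp)
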